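/- Let $\alpha<1$ be a real number and $1\le p\le\infty$ (with $\frac1p=0$ for $p=\infty$). For every $f\in L^p(0,1)$ there is a unique function $u_N\in W^{2,p}_{loc}((0,1])$ (that is, $u_N\in W^{2,p}(\varepsilon,1)$ for every $0<\varepsilon<1$; $u_N$ is identified with its $C^1((0,1])$ representative) that solves the weighted Neumann problem $$-(x^{2\alpha}u_N'(x))'+u_N(x)=f(x)\ \text{ for a.e. } x\in(0,1),\qquad u_N(1)=0,\qquad \lim_{x\to0^+}x^{2\alpha}u_N'(x)=0 .$$ The boundary rate $x^{2\alpha-1+\frac1p}u_N'(x)$ is optimal in the following sense. For $0<x<1$ put $$K_N(x)=\sup_{\|f\|_{L^p(0,1)}\le 1}\left|x^{2\alpha-1+\frac1p}\,u_N'(x)\right| ,$$ where $u_N$ is the solution with right-hand side $f$. Then there exist $\varepsilon_0\in(0,1)$ and constants $0<C_1<C_2$ (depending only on $\alpha$ and $p$) such that $$C_1\le K_N(x)\le C_2\qquad\text{for all } 0<x\le\varepsilon_0 .$$ -/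

import Mathlib

open MeasureTheory Set Filter
open scoped Topology ENNReal ContDiff

namespace SingularSL

/-- `h` is the weak (distributional) derivative of `g` on the open interval `(0,1)`. -/
def HasWeakDeriv (g h : ℝ → ℝ) : Prop :=
  LocallyIntegrableOn g (Ioo 0 1) ∧ LocallyIntegrableOn h (Ioo 0 1) ∧
    ∀ φ : ℝ → ℝ, ContDiff ℝ ∞ φ → HasCompactSupport φ → tsupport φ ⊆ Ioo 0 1 →
      ∫ x in Ioo (0 : ℝ) 1, g x * deriv φ x = -∫ x in Ioo (0 : ℝ) 1, h x * φ x

/-- The space `W^{2,p}_loc((0,1])`: `u` has first and second weak derivatives on `(0,1)`, and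
`u`, `u'`, `u''` belong to `L^p(ε,1)` for every `0 < ε < 1`. -/
def MemW2pLoc (p : ℝ≥0∞) (u : ℝ → ℝ) : Prop :=
  ∃ u₁ u₂ : ℝ → ℝ, HasWeakDeriv u u₁ ∧ HasWeakDeriv u₁ u₂ ∧
    ∀ ε : ℝ, 0 < ε → ε < 1 →
      MemLp u p (volume.restrict (Ioo ε 1)) ∧
      MemLp u₁ p (volume.restrict (Ioo ε 1)) ∧
      MemLp u₂ p (volume.restrict (Ioo ε 1))

/-- `u` is a solution in `W^{2,p}_loc((0,1])` of the Neumann problem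
`-(x^{2α} u')' + u = f` a.e. in `(0,1)`, `u(1) = 0`, `lim_{x → 0⁺} x^{2α} u'(x) = 0`.

A function of `W^{2,p}_loc((0,1])` is identified with its continuous representative on `(0,1]`
(field `continuousOn`). That representative is `C^1`, so that `deriv u` is, at every point of
`(0,1)`, the classical derivative and is also the weak derivative of `u`. Only the values of `u` on
`(0,1]` matter. -/
structure IsNeumannSolution (α : ℝ) (p : ℝ≥0∞) (f u : ℝ → ℝ) : Prop where
  continuousOn : ContinuousOn u (Ioc 0 1)
  memW2pLoc : MemW2pLoc p u
  equation : ∃ w : ℝ → ℝ, HasWeakDeriv (fun x => x ^ (2 * α) * deriv u x) w ∧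
    ∀ᵐ x ∂(volume.restrict (Ioo (0 : ℝ) 1)), -w x + u x = f x
  right_boundary : u 1 = 0
  neumann_boundary : Tendsto (fun x => x ^ (2 * α) * deriv u x) (𝓝[>] 0) (𝓝 0)

/-- `K_N(x) = sup { |x^{2α - 1 + 1/p} u_N'(x)| : f ∈ L^p(0,1), ‖f‖_{L^p} ≤ 1 }`, as a supremum in
`[0,∞]`, where `u_N` is the solution of the Neumann problem with right-hand side `f`
(and `1/p = 0` when `p = ∞`). -/
noncomputable def neumannK (α : ℝ) (p : ℝ≥0∞) (x : ℝ) : ℝ≥0∞ :=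
  ⨆ (f : ℝ → ℝ) (uN : ℝ → ℝ) (_ : MemLp f p (volume.restrict (Ioo 0 1)))
    (_ : eLpNorm f p (volume.restrict (Ioo 0 1)) ≤ 1) (_ : IsNeumannSolution α p f uN),
    ENNReal.ofReal |x ^ (2 * α - 1 + (p⁻¹).toReal) * deriv uN x|

end SingularSL

namespace SingularSL

/-! The homogeneous equation `(x^{2α} φ')' = φ` has a solution regular at 0, with `1 ≤ φ ≤ A` and
flux `σ = x^{2α} φ' = O(x)` on `(0,1]` (`exists_isRegularSolution`). Put `J(x) = ∫_0^x φ f`.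
Reduction of order gives the solution `u = φ V`, `V(x) = ∫_x^1 s^{-2α} J(s) / φ(s)^2 ds`, whose flux
is `x^{2α} u' = σ V - J / φ`. An energy argument for the first-order system of `u` and its flux
gives uniqueness (`eq_zero_of_homogeneous_system`), so the supremum concerns this formula only.

With `θ = 1 - 1/p` the rate is `x^{-θ}` times the flux. Hölder gives `|J(s)| ≤ A s^θ`, and since `α
< 1` the integral `x V(x)` is also `O(x^θ)`; this is the upper bound (`neumannK_le`). For the lower
bound (`le_neumannK`), take `f` to be the normalized indicator of `(0,x)`: then `J` is constant on
`[x,1]` and comparable to `x^θ`, while `σ V` is smaller by a factor `O(x^{1-β})` with `β < 1`, so `J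
/ φ` dominates for small `x`.

Weak derivatives are handled through locally absolutely continuous functions, by the lemma of du
Bois-Reymond. -/

/-! ### Locally absolutely continuous functions on `(0,1)`. -/

theorem exists_Ioo_of_isCompact_subset {K : Set ℝ} (hK : IsCompact K) (h : K ⊆ Ioo 0 1) :
    ∃ a b : ℝ, 0 < a ∧ a < b ∧ b < 1 ∧ K ⊆ Ioo a b := by
  rcases K.eq_empty_or_nonempty with rfl | hne
  · exact ⟨1 / 3, 1 / 2, by norm_num, by norm_num, by norm_num, empty_subset _⟩
  obtain ⟨m, hm, hm'⟩ := hK.exists_isLeast hne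
  obtain ⟨M, hM, hM'⟩ := hK.exists_isGreatest hne
  have h1 := h hm
  have h2 := h hM
  have h3 : m ≤ M := hm' hM
  simp only [mem_Ioo] at h1 h2
  refine ⟨m / 2, (M + 1) / 2, by linarith, by linarith, by linarith, fun x hx => ?_⟩
  have h4 : m ≤ x := hm' hx
  have h5 : x ≤ M := hM' hx
  constructor <;> linarith

theorem uIcc_subset_Ioo_zero_one {a b : ℝ} (ha : a ∈ Ioo (0 : ℝ) 1) (hb : b ∈ Ioo (0 : ℝ) 1) :
    uIcc a b ⊆ Ioo (0 : ℝ) 1 :=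
  ordConnected_Ioo.uIcc_subset ha hb

theorem ae_Ioo_of_forall_uIcc {P : ℝ → Prop}
    (h : ∀ a ∈ Ioo (0 : ℝ) 1, ∀ b ∈ Ioo (0 : ℝ) 1, ∀ᵐ x, x ∈ uIcc a b → P x) :
    ∀ᵐ x, x ∈ Ioo (0 : ℝ) 1 → P x := by
  have h' : ∀ n : ℕ, ∀ᵐ x : ℝ, x ∈ uIcc (1 / ((n : ℝ) + 2)) (1 - 1 / ((n : ℝ) + 2)) → P x := by
    intro n
    have h2 : (0 : ℝ) < 1 / ((n : ℝ) + 2) := by positivity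
    have h3 : 1 / ((n : ℝ) + 2) < 1 := by
      rw [div_lt_one (by positivity)]
      have : (0 : ℝ) ≤ n := n.cast_nonneg
      linarith
    exact h _ ⟨h2, h3⟩ _ ⟨by linarith, by linarith⟩
  filter_upwards [ae_all_iff.2 h'] with x hx hx1
  obtain ⟨n, hn⟩ := exists_nat_one_div_lt (lt_min hx1.1 (sub_pos.2 hx1.2))
  have hle : 1 / ((n : ℝ) + 2) ≤ 1 / ((n : ℝ) + 1) := by
    apply one_div_le_one_div_of_le <;> [positivity; linarith]
  refine hx n (Icc_subset_uIcc ⟨?_, ?_⟩)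
  · exact hle.trans (hn.le.trans (min_le_left _ _))
  · have := hle.trans (hn.le.trans (min_le_right _ _))
    linarith

/-- `g` is locally absolutely continuous on `(0,1)` and its derivative is `h` almost everywhere. -/
def HasACDeriv (g h : ℝ → ℝ) : Prop :=
  (∀ a ∈ Ioo (0 : ℝ) 1, ∀ b ∈ Ioo (0 : ℝ) 1, AbsolutelyContinuousOnInterval g a b) ∧
    ∀ᵐ x, x ∈ Ioo (0 : ℝ) 1 → HasDerivAt g (h x) x

namespace HasACDeriv

variable {g h k l : ℝ → ℝ}

theorem mul (hg : HasACDeriv g h) (hk : HasACDeriv k l) :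
    HasACDeriv (fun x => g x * k x) (fun x => h x * k x + g x * l x) := by
  refine ⟨fun a ha b hb => (hg.1 a ha b hb).mul (hk.1 a ha b hb), ?_⟩
  filter_upwards [hg.2, hk.2] with x h1 h2 hx
  exact (h1 hx).mul (h2 hx)

theorem add (hg : HasACDeriv g h) (hk : HasACDeriv k l) :
    HasACDeriv (fun x => g x + k x) (fun x => h x + l x) := by
  refine ⟨fun a ha b hb => (hg.1 a ha b hb).add (hk.1 a ha b hb), ?_⟩
  filter_upwards [hg.2, hk.2] with x h1 h2 hx
  exact (h1 hx).add (h2 hx)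

theorem sub (hg : HasACDeriv g h) (hk : HasACDeriv k l) :
    HasACDeriv (fun x => g x - k x) (fun x => h x - l x) := by
  refine ⟨fun a ha b hb => (hg.1 a ha b hb).sub (hk.1 a ha b hb), ?_⟩
  filter_upwards [hg.2, hk.2] with x h1 h2 hx
  exact (h1 hx).sub (h2 hx)

theorem continuousOn (hg : HasACDeriv g h) : ContinuousOn g (Ioo 0 1) := by
  intro x hx
  have ha : x / 2 ∈ Ioo (0 : ℝ) 1 := ⟨by linarith [hx.1], by linarith [hx.1, hx.2]⟩
  have hb : (x + 1) / 2 ∈ Ioo (0 : ℝ) 1 := ⟨by linarith [hx.1], by linarith [hx.1, hx.2]⟩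
  have h1 := (hg.1 _ ha _ hb).continuousOn
  refine (h1.continuousAt ?_).continuousWithinAt
  rw [uIcc_of_le (by linarith [hx.1])]
  exact Icc_mem_nhds (by linarith [hx.1]) (by linarith [hx.2])

theorem congr_deriv (hg : HasACDeriv g h) (hk : ∀ᵐ x, x ∈ Ioo (0 : ℝ) 1 → h x = k x) :
    HasACDeriv g k := by
  refine ⟨hg.1, ?_⟩
  filter_upwards [hg.2, hk] with x h1 h2 hx
  exact h2 hx ▸ h1 hx

theorem ae_deriv_eq (hg : HasACDeriv g h) : ∀ᵐ x, x ∈ Ioo (0 : ℝ) 1 → deriv g x = h x := by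
  filter_upwards [hg.2] with x h1 hx
  exact (h1 hx).deriv

theorem intervalIntegrable (hg : HasACDeriv g h) {a b : ℝ} (ha : a ∈ Ioo (0 : ℝ) 1)
    (hb : b ∈ Ioo (0 : ℝ) 1) : IntervalIntegrable h volume a b := by
  refine ((hg.1 a ha b hb).intervalIntegrable_deriv).congr_ae ?_
  rw [EventuallyEq, ae_restrict_iff' measurableSet_uIoc]
  filter_upwards [hg.ae_deriv_eq] with x hx hx'
  exact hx (uIcc_subset_Ioo_zero_one ha hb (uIoc_subset_uIcc hx'))

theorem integral_eq_sub (hg : HasACDeriv g h) {a b : ℝ} (ha : a ∈ Ioo (0 : ℝ) 1)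
    (hb : b ∈ Ioo (0 : ℝ) 1) : ∫ x in a..b, h x = g b - g a := by
  rw [← (hg.1 a ha b hb).integral_deriv_eq_sub]
  refine intervalIntegral.integral_congr_ae ?_
  filter_upwards [hg.ae_deriv_eq] with x hx hx'
  exact (hx (uIcc_subset_Ioo_zero_one ha hb (uIoc_subset_uIcc hx'))).symm

theorem locallyIntegrableOn (hg : HasACDeriv g h) : LocallyIntegrableOn h (Ioo 0 1) := by
  rw [locallyIntegrableOn_iff isOpen_Ioo.isLocallyClosed]
  intro K hK hK'
  obtain ⟨a, b, ha, hab, hb, hs⟩ := exists_Ioo_of_isCompact_subset hK' hK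
  have := hg.intervalIntegrable (a := a) (b := b) ⟨ha, by linarith⟩ ⟨by linarith, hb⟩
  rw [intervalIntegrable_iff_integrableOn_Ioo_of_le hab.le] at this
  exact this.mono_set hs

theorem of_hasDerivAt (hh : ContinuousOn h (Ioo 0 1))
    (hg : ∀ x ∈ Ioo (0 : ℝ) 1, HasDerivAt g (h x) x) : HasACDeriv g h := by
  refine ⟨fun a ha b hb => ?_, ae_of_all _ hg⟩
  have hs := uIcc_subset_Ioo_zero_one ha hb
  have : ContDiffOn ℝ 1 g (Ioo 0 1) := by
    rw [show (1 : WithTop ℕ∞) = 0 + 1 by simp, contDiffOn_succ_iff_deriv_of_isOpen isOpen_Ioo]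
    refine ⟨fun x hx => (hg x hx).differentiableAt.differentiableWithinAt, by simp, ?_⟩
    exact contDiffOn_zero.2 (hh.congr fun x hx => (hg x hx).deriv)
  exact (this.mono hs).absolutelyContinuousOnInterval

theorem of_integral (hh : LocallyIntegrableOn h (Ioo 0 1)) {c : ℝ} (hc : c ∈ Ioo (0 : ℝ) 1) :
    HasACDeriv (fun x => ∫ t in c..x, h t) h := by
  have hi : ∀ a ∈ Ioo (0 : ℝ) 1, ∀ b ∈ Ioo (0 : ℝ) 1, IntervalIntegrable h volume a b :=
    fun a ha b hb => (hh.integrableOn_compact_subset (uIcc_subset_Ioo_zero_one ha hb)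
      isCompact_uIcc).intervalIntegrable
  -- The interval is enlarged to contain the base point `c` of the primitive.
  have hsub : ∀ a ∈ Ioo (0 : ℝ) 1, ∀ b ∈ Ioo (0 : ℝ) 1,
      ∃ a' ∈ Ioo (0 : ℝ) 1, ∃ b' ∈ Ioo (0 : ℝ) 1, uIcc a b ⊆ uIcc a' b' ∧ c ∈ uIcc a' b' := by
    intro a ha b hb
    refine ⟨min c (min a b), ⟨by simp [ha.1, hb.1, hc.1], (min_le_left _ _).trans_lt hc.2⟩,
      max c (max a b), ⟨lt_max_of_lt_left hc.1, by simp [ha.2, hb.2, hc.2]⟩, ?_, ?_⟩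
    · exact (Icc_subset_Icc (min_le_right _ _) (le_max_right _ _)).trans Icc_subset_uIcc
    · exact Icc_subset_uIcc ⟨min_le_left _ _, le_max_left _ _⟩
  refine ⟨fun a ha b hb => ?_, ae_Ioo_of_forall_uIcc fun a ha b hb => ?_⟩
  · obtain ⟨a', ha', b', hb', h1, h2⟩ := hsub a ha b hb
    exact ((hi a' ha' b' hb').absolutelyContinuousOnInterval_intervalIntegral h2).mono h1
  · obtain ⟨a', ha', b', hb', h1, h2⟩ := hsub a ha b hb
    filter_upwards [(hi a' ha' b' hb').ae_hasDerivAt_integral] with x hx hx'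
    exact hx (h1 hx') c h2

/-- The base point 0 lies outside the open interval, so local integrability on `(0,1)` would not
suffice here. -/
theorem of_integral_zero (hh : Integrable h) : HasACDeriv (fun x => ∫ t in (0 : ℝ)..x, h t) h :=
  ⟨fun _ _ _ _ => ((hh.intervalIntegrable (a := min 0 (min _ _)) (b := max 0 (max _ _))
      ).absolutelyContinuousOnInterval_intervalIntegral
      (Icc_subset_uIcc ⟨min_le_left _ _, le_max_left _ _⟩)).mono
      ((Icc_subset_Icc (min_le_right _ _) (le_max_right _ _)).trans Icc_subset_uIcc), by
    filter_upwards [_root_.LocallyIntegrable.ae_hasDerivAt_integral hh.locallyIntegrable] with x hx _ using hx 0⟩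

/-- An absolutely continuous function whose a.e. derivative has a continuous version is
continuously differentiable. -/
theorem hasDerivAt (hg : HasACDeriv g h) (hk : ∀ᵐ x, x ∈ Ioo (0 : ℝ) 1 → h x = k x)
    (hc : ContinuousOn k (Ioo 0 1)) {x : ℝ} (hx : x ∈ Ioo (0 : ℝ) 1) : HasDerivAt g (k x) x := by
  have hg' := hg.congr_deriv hk
  have h2 : (1 / 2 : ℝ) ∈ Ioo (0 : ℝ) 1 := by norm_num
  have h1 : HasDerivAt (fun y => g (1 / 2) + ∫ t in (1 / 2 : ℝ)..y, k t) (k x) x := by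
    refine (intervalIntegral.integral_hasDerivAt_right (hg'.intervalIntegrable h2 hx)
      (hc.stronglyMeasurableAtFilter isOpen_Ioo x hx) (hc.continuousAt (isOpen_Ioo.mem_nhds hx))
      ).const_add _
  refine h1.congr_of_eventuallyEq ?_
  filter_upwards [isOpen_Ioo.mem_nhds hx] with y hy
  rw [hg'.integral_eq_sub h2 hy]
  ring

/-- Integrate `(g φ)'` over an interval `(a,b)` containing the support of `φ`; the boundary terms
vanish. -/
theorem hasWeakDeriv (hg : HasACDeriv g h) : HasWeakDeriv g h := by
  refine ⟨hg.continuousOn.locallyIntegrableOn measurableSet_Ioo, hg.locallyIntegrableOn, ?_⟩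
  intro φ hφ hφc hφs
  obtain ⟨a, b, ha, hab, hb, hs⟩ := exists_Ioo_of_isCompact_subset hφc hφs
  have ha' : a ∈ Ioo (0 : ℝ) 1 := ⟨ha, by linarith⟩
  have hb' : b ∈ Ioo (0 : ℝ) 1 := ⟨by linarith, hb⟩
  have hφd : Continuous (deriv φ) := hφ.continuous_deriv (by simp)
  have hφ' : HasACDeriv φ (deriv φ) := of_hasDerivAt hφd.continuousOn
    fun x _ => (hφ.differentiable (by simp) x).hasDerivAt
  have h0 : ∀ x ∉ Ioo a b, φ x = 0 := fun x hx => image_eq_zero_of_notMem_tsupport fun h => hx (hs h)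
  have h0' : ∀ x ∉ Ioo a b, deriv φ x = 0 := fun x hx =>
    image_eq_zero_of_notMem_tsupport fun h => hx (hs (tsupport_deriv_subset h))
  have key := (hg.mul hφ').integral_eq_sub ha' hb'
  rw [h0 a (by simp), h0 b (by simp), mul_zero, mul_zero, sub_zero,
    intervalIntegral.integral_add ((hg.intervalIntegrable ha' hb').mul_continuousOn
      hφ.continuous.continuousOn) ((hφd.intervalIntegrable _ _).continuousOn_mul
      (hg.continuousOn.mono (uIcc_subset_Ioo_zero_one ha' hb')))] at key
  have hsub : ∀ F : ℝ → ℝ, (∀ x ∉ Ioo a b, F x = 0) →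
      ∫ x in Ioo (0 : ℝ) 1, F x = ∫ x in a..b, F x := by
    intro F hF
    rw [intervalIntegral.integral_of_le hab.le, integral_Ioc_eq_integral_Ioo]
    exact setIntegral_eq_of_subset_of_forall_sdiff_eq_zero measurableSet_Ioo
      (Ioo_subset_Ioo ha.le hb.le) fun x hx => hF x hx.2
  rw [hsub _ fun x hx => by rw [h0' x hx, mul_zero], hsub _ fun x hx => by rw [h0 x hx, mul_zero]]
  linarith

end HasACDeriv

/-! ### Test functions, and weak derivatives as a.e. derivatives. -/

theorem exists_testFunction_integral_eq_one :
    ∃ η : ℝ → ℝ, ContDiff ℝ ∞ η ∧ HasCompactSupport η ∧ tsupport η ⊆ Ioo 0 1 ∧ ∫ x, η x = 1 := by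
  let f : ContDiffBump (1 / 2 : ℝ) := ⟨1 / 8, 1 / 4, by norm_num, by norm_num⟩
  refine ⟨f.normed volume, f.contDiff_normed, f.hasCompactSupport_normed, ?_, f.integral_normed⟩
  rw [f.tsupport_normed_eq]
  intro x hx
  rw [Metric.mem_closedBall, Real.dist_eq, abs_le] at hx
  have hr : f.rOut = 1 / 4 := rfl
  rw [hr] at hx
  constructor <;> linarith [hx.1, hx.2]

/-- The primitive of a test function with vanishing integral is a test function. -/
theorem exists_testFunction_primitive {ψ : ℝ → ℝ} (hψ : ContDiff ℝ ∞ ψ) (hc : HasCompactSupport ψ)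
    (hs : tsupport ψ ⊆ Ioo 0 1) (h0 : ∫ x, ψ x = 0) :
    ∃ φ : ℝ → ℝ, ContDiff ℝ ∞ φ ∧ HasCompactSupport φ ∧ tsupport φ ⊆ Ioo 0 1 ∧ deriv φ = ψ := by
  obtain ⟨a, b, ha, hab, hb, hK⟩ := exists_Ioo_of_isCompact_subset hc hs
  have hz : ∀ x ∉ Ioo a b, ψ x = 0 := fun x hx => image_eq_zero_of_notMem_tsupport fun h => hx (hK h)
  have hd : ∀ x, HasDerivAt (fun x => ∫ t in a..x, ψ t) (ψ x) x := fun x =>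
    intervalIntegral.integral_hasDerivAt_right (hψ.continuous.intervalIntegrable _ _)
      hψ.continuous.aestronglyMeasurable.stronglyMeasurableAtFilter hψ.continuous.continuousAt
  have hd' : deriv (fun x => ∫ t in a..x, ψ t) = ψ := funext fun x => (hd x).deriv
  have hab0 : ∫ t in a..b, ψ t = 0 := by
    rw [intervalIntegral.integral_of_le hab.le, integral_Ioc_eq_integral_Ioo,
      setIntegral_eq_integral_of_forall_compl_eq_zero hz, h0]
  have hzero : ∀ x ∉ Icc a b, ∫ t in a..x, ψ t = 0 := by
    intro x hx
    rcases lt_or_ge x a with h | h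
    · refine intervalIntegral.integral_zero_ae (ae_of_all _ fun t ht => hz t fun h' => ?_)
      rw [uIoc_of_ge h.le] at ht
      linarith [ht.2, h'.1]
    · have hxb : b < x := by
        by_contra! h'
        exact hx ⟨h, h'⟩
      rw [← intervalIntegral.integral_add_adjacent_intervals
        (hψ.continuous.intervalIntegrable a b) (hψ.continuous.intervalIntegrable b x), hab0, zero_add]
      refine intervalIntegral.integral_zero_ae (ae_of_all _ fun t ht => hz t fun h' => ?_)
      rw [uIoc_of_le hxb.le] at ht
      linarith [ht.1, h'.2]
  have hts : tsupport (fun x => ∫ t in a..x, ψ t) ⊆ Icc a b :=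
    closure_minimal (fun x hx => by
      by_contra h
      exact hx (hzero x h)) isClosed_Icc
  refine ⟨_, ?_, HasCompactSupport.intro isCompact_Icc hzero,
    hts.trans fun x hx => ⟨ha.trans_le hx.1, hx.2.trans_lt hb⟩, hd'⟩
  rw [contDiff_infty_iff_deriv, hd']
  exact ⟨fun x => (hd x).differentiableAt, hψ⟩

theorem LocallyIntegrableOn.integrable_mul_testFunction {g φ : ℝ → ℝ}
    (hg : LocallyIntegrableOn g (Ioo 0 1)) (hφ : Continuous φ) (hc : HasCompactSupport φ)
    (hs : tsupport φ ⊆ Ioo 0 1) : Integrable (fun x => g x * φ x) := by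
  have h1 := (hg.integrableOn_compact_subset hs hc).mul_continuousOn hφ.continuousOn hc
  rwa [integrableOn_iff_integrable_of_support_subset] at h1
  intro x hx
  exact subset_tsupport _ (right_ne_zero_of_mul hx)

theorem setIntegral_Ioo_testFunction {g φ : ℝ → ℝ} (hs : tsupport φ ⊆ Ioo 0 1) :
    ∫ x in Ioo (0 : ℝ) 1, g x * φ x = ∫ x, g x * φ x :=
  setIntegral_eq_integral_of_forall_compl_eq_zero fun x hx => by
    rw [image_eq_zero_of_notMem_tsupport fun h => hx (hs h), mul_zero]

/-- The lemma of du Bois-Reymond. -/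
theorem ae_eq_const_of_weakDeriv_zero {g : ℝ → ℝ} (hg : LocallyIntegrableOn g (Ioo 0 1))
    (h : ∀ φ : ℝ → ℝ, ContDiff ℝ ∞ φ → HasCompactSupport φ → tsupport φ ⊆ Ioo 0 1 →
      ∫ x in Ioo (0 : ℝ) 1, g x * deriv φ x = 0) :
    ∃ c, ∀ᵐ x, x ∈ Ioo (0 : ℝ) 1 → g x = c := by
  obtain ⟨η, hη, hηc, hηs, hη1⟩ := exists_testFunction_integral_eq_one
  refine ⟨∫ x, g x * η x, ?_⟩
  have hlc : LocallyIntegrableOn (fun x => g x - ∫ x, g x * η x) (Ioo 0 1) :=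
    hg.sub ((locallyIntegrable_const _).locallyIntegrableOn _)
  have := isOpen_Ioo.ae_eq_zero_of_integral_contDiff_smul_eq_zero hlc (μ := volume) ?_
  · filter_upwards [this] with x hx hx' using sub_eq_zero.1 (hx hx')
  intro ψ hψ hψc hψs
  have hψi : Integrable ψ := hψ.continuous.integrable_of_hasCompactSupport hψc
  have hηi : Integrable η := hη.continuous.integrable_of_hasCompactSupport hηc
  have hgψ := LocallyIntegrableOn.integrable_mul_testFunction hg hψ.continuous hψc hψs
  have hgη := LocallyIntegrableOn.integrable_mul_testFunction hg hη.continuous hηc hηs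
  set m := ∫ x, ψ x with hm
  have hts : tsupport (fun x => ψ x - m * η x) ⊆ tsupport ψ ∪ tsupport η := by
    refine closure_minimal (fun x hx => ?_) ((isClosed_tsupport _).union (isClosed_tsupport _))
    by_contra h'
    rw [mem_union, not_or] at h'
    apply hx
    simp only [image_eq_zero_of_notMem_tsupport h'.1, image_eq_zero_of_notMem_tsupport h'.2]
    ring
  -- Subtracting `m η` makes the mean zero, so the difference is the derivative of a test function
  -- and the hypothesis applies to it.
  obtain ⟨φ, hφ, hφc, hφs, hφd⟩ := exists_testFunction_primitive (ψ := fun x => ψ x - m * η x)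
    (hψ.sub (contDiff_const.mul hη))
    ((hψc.isCompact.union hηc.isCompact).of_isClosed_subset (isClosed_tsupport _) hts)
    (hts.trans (union_subset hψs hηs))
    (by rw [integral_sub hψi (hηi.const_mul _), integral_const_mul, hη1, mul_one, sub_self])
  have h1 := h φ hφ hφc hφs
  rw [hφd, setIntegral_Ioo_testFunction (hts.trans (union_subset hψs hηs))] at h1
  have e1 : ∀ x, g x * (ψ x - m * η x) = g x * ψ x - m * (g x * η x) := fun x => by ring
  simp_rw [e1] at h1
  rw [integral_sub hgψ (hgη.const_mul _), integral_const_mul] at h1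
  have e2 : ∀ x, ψ x • (g x - ∫ x, g x * η x) = g x * ψ x - (∫ x, g x * η x) * ψ x := fun x => by
    rw [smul_eq_mul]; ring
  simp_rw [e2]
  rw [integral_sub hgψ (hψi.const_mul _), integral_const_mul]
  linarith

/-- A primitive of `h` has the same weak derivative as `g`, so the two differ by a constant a.e. -/
theorem HasWeakDeriv.exists_hasACDeriv {g h : ℝ → ℝ} (hgh : HasWeakDeriv g h) :
    ∃ G, HasACDeriv G h ∧ ∀ᵐ x, x ∈ Ioo (0 : ℝ) 1 → g x = G x := by
  have hH := HasACDeriv.of_integral hgh.2.1 (c := 1 / 2) (by norm_num)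
  set H := fun x => ∫ t in (1 / 2 : ℝ)..x, h t
  have hw := hH.hasWeakDeriv
  obtain ⟨c, hc⟩ := ae_eq_const_of_weakDeriv_zero (g := fun x => g x - H x) (hgh.1.sub hw.1) (by
    intro φ hφ hφc hφs
    have hd : Continuous (deriv φ) := hφ.continuous_deriv (by simp)
    have hds : tsupport (deriv φ) ⊆ Ioo 0 1 := (tsupport_deriv_subset).trans hφs
    have h1 := LocallyIntegrableOn.integrable_mul_testFunction hgh.1 hd hφc.deriv hds
    have h2 := LocallyIntegrableOn.integrable_mul_testFunction hw.1 hd hφc.deriv hds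
    simp_rw [sub_mul]
    rw [integral_sub h1.integrableOn h2.integrableOn, hgh.2.2 φ hφ hφc hφs,
      hw.2.2 φ hφ hφc hφs, sub_self])
  refine ⟨fun x => H x + c, ?_, ?_⟩
  · have hcst : HasACDeriv (fun _ => c) (fun _ => 0) :=
      HasACDeriv.of_hasDerivAt continuousOn_const fun x _ => hasDerivAt_const x c
    simpa using hH.add hcst
  · filter_upwards [hc] with x hx hx'
    linarith [hx hx']

theorem eqOn_Ioo_of_ae_eq {g G : ℝ → ℝ} (hg : ContinuousOn g (Ioo 0 1))
    (hG : ContinuousOn G (Ioo 0 1)) (h : ∀ᵐ x, x ∈ Ioo (0 : ℝ) 1 → g x = G x) :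
    EqOn g G (Ioo 0 1) :=
  Measure.eqOn_open_of_ae_eq ((ae_restrict_iff' measurableSet_Ioo).2 h) isOpen_Ioo hg hG

theorem HasACDeriv.congr {g G h : ℝ → ℝ} (hG : HasACDeriv G h) (he : EqOn g G (Ioo 0 1)) :
    HasACDeriv g h := by
  refine ⟨fun a ha b hb => ?_, ?_⟩
  · have hs := uIcc_subset_Ioo_zero_one ha hb
    refine (hG.1 a ha b hb).congr' (mem_inf_of_right fun E hE => Finset.sum_congr rfl fun i hi => ?_)
    rw [he (hs (hE.1 i hi).1), he (hs (hE.1 i hi).2)]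
  · filter_upwards [hG.2] with x hx hx'
    exact (hx hx').congr_of_eventuallyEq (he.eventuallyEq_of_mem (isOpen_Ioo.mem_nhds hx'))

theorem HasWeakDeriv.hasACDeriv {g h : ℝ → ℝ} (hgh : HasWeakDeriv g h)
    (hg : ContinuousOn g (Ioo 0 1)) : HasACDeriv g h := by
  obtain ⟨G, hG, hgG⟩ := hgh.exists_hasACDeriv
  exact hG.congr (eqOn_Ioo_of_ae_eq hg hG.continuousOn hgG)

/-! ### Uniqueness for the Neumann problem. -/

/-- Uniqueness for the system `z' = d`, `d' = k z` with `k > 0`, in the form needed for the weighted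
Neumann problem: `z` vanishes at `0` and `d` vanishes at `1`. -/
theorem eq_zero_of_homogeneous_system {d z k : ℝ → ℝ} (hdc : ContinuousOn d (Ioc 0 1))
    (hd1 : d 1 = 0) (hk : ∀ x ∈ Ioo (0 : ℝ) 1, 0 < k x)
    (hd : ∀ x ∈ Ioo (0 : ℝ) 1, HasDerivAt d (k x * z x) x)
    (hz : ∀ x ∈ Ioo (0 : ℝ) 1, HasDerivAt z (d x) x) (hz0 : Tendsto z (𝓝[>] 0) (𝓝 0)) :
    ∀ x ∈ Ioc (0 : ℝ) 1, d x = 0 := by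
  -- `(z d)' = d^2 + k z^2 ≥ 0`. Nothing bounds `d` near 0, so only the limit of `z d` at 1 is
  -- available; it gives `z d ≤ 0`.
  have hmono : MonotoneOn (fun x => z x * d x) (Ioo 0 1) := by
    refine monotoneOn_of_hasDerivWithinAt_nonneg (convex_Ioo 0 1)
      (f' := fun x => d x * d x + z x * (k x * z x))
      (fun x hx => ((hz x hx).mul (hd x hx)).continuousAt.continuousWithinAt) ?_ ?_
    · intro x hx
      rw [interior_Ioo] at hx
      exact ((hz x hx).mul (hd x hx)).hasDerivWithinAt
    · intro x hx
      rw [interior_Ioo] at hx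
      nlinarith [mul_nonneg (hk x hx).le (mul_self_nonneg (z x)), mul_self_nonneg (d x)]
  have hlim : Tendsto (fun x => z x * d x) (𝓝[<] 1) (𝓝 0) := by
    obtain ⟨M, hM⟩ := (isCompact_Icc (a := (1 / 2 : ℝ)) (b := 1)).exists_bound_of_continuousOn
      (hdc.mono fun x hx => ⟨by linarith [hx.1], hx.2⟩)
    have hzb : ∀ x ∈ Ioo (1 / 2 : ℝ) 1, ‖z x‖ ≤ ‖z (1 / 2)‖ + M * (1 / 2) := by
      intro x hx
      have h1 : ‖z x - z (1 / 2)‖ ≤ M * (x - 1 / 2) := by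
        refine norm_image_sub_le_of_norm_deriv_le_segment' (f' := d) (fun y hy => ?_)
          (fun y hy => hM y ⟨hy.1, by linarith [hy.2, hx.2]⟩) x ⟨hx.1.le, le_rfl⟩
        exact (hz y ⟨by linarith [hy.1], by linarith [hy.2, hx.2]⟩).hasDerivWithinAt
      have hM0 : 0 ≤ M := (norm_nonneg _).trans (hM 1 (by norm_num))
      have h2 := norm_le_norm_add_norm_sub' (z x) (z (1 / 2))
      nlinarith [hx.2]
    have hdl : Tendsto d (𝓝[<] 1) (𝓝 0) := by
      rw [← hd1]
      refine (hdc 1 (by norm_num)).mono_left ?_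
      rw [← nhdsWithin_Ioo_eq_nhdsLT (zero_lt_one' ℝ)]
      exact nhdsWithin_mono _ Ioo_subset_Ioc_self
    refine hdl.zero_mul_isBoundedUnder_le ?_ |>.congr fun x => mul_comm _ _
    refine isBoundedUnder_of_eventually_le (a := ‖z (1 / 2)‖ + M * (1 / 2)) ?_
    filter_upwards [Ioo_mem_nhdsLT (show (1 / 2 : ℝ) < 1 by norm_num)] with x hx using hzb x hx
  have hle : ∀ x ∈ Ioo (0 : ℝ) 1, z x * d x ≤ 0 := by
    intro x hx
    refine ge_of_tendsto hlim ?_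
    filter_upwards [Ioo_mem_nhdsLT hx.2] with y hy
    exact hmono hx ⟨hx.1.trans hy.1, hy.2⟩ hy.1.le
  -- `(d^2)' = 2 k z d ≤ 0`: if `d x ≠ 0`, then `d` has no zero on `(0,x]` and keeps its sign there.
  have hanti : AntitoneOn (fun x => d x * d x) (Ioo 0 1) := by
    refine antitoneOn_of_hasDerivWithinAt_nonpos (convex_Ioo 0 1)
      (f' := fun x => k x * z x * d x + d x * (k x * z x))
      (fun x hx => ((hd x hx).mul (hd x hx)).continuousAt.continuousWithinAt) ?_ ?_
    · intro x hx
      rw [interior_Ioo] at hx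
      exact ((hd x hx).mul (hd x hx)).hasDerivWithinAt
    · intro x hx
      rw [interior_Ioo] at hx
      nlinarith [mul_nonneg (hk x hx).le (neg_nonneg.2 (hle x hx))]
  intro x hx
  rcases hx.2.eq_or_lt with rfl | hx1
  · exact hd1
  by_contra hne
  have hxI : x ∈ Ioo (0 : ℝ) 1 := ⟨hx.1, hx1⟩
  have hsub : Ioc 0 x ⊆ Ioo (0 : ℝ) 1 := fun y hy => ⟨hy.1, hy.2.trans_lt hx1⟩
  have hnz : ∀ y ∈ Ioc 0 x, d y ≠ 0 := by
    intro y hy h0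
    have := hanti (hsub hy) hxI hy.2
    simp only [h0, mul_zero] at this
    exact absurd this (not_le.2 (mul_self_pos.2 hne))
  have hsign : ∀ y ∈ Ioc 0 x, 0 < d x * d y := by
    intro y hy
    by_contra! hneg
    have hc : ContinuousOn (fun t => d x * d t) (Icc y x) :=
      continuousOn_const.mul (hdc.mono fun t ht => ⟨hy.1.trans_le ht.1, ht.2.trans hx.2⟩)
    obtain ⟨t, ht, ht0⟩ := intermediate_value_Icc hy.2 hc ⟨hneg, (mul_self_pos.2 hne).le⟩
    exact mul_ne_zero hne (hnz t ⟨hy.1.trans_le ht.1, ht.2⟩) ht0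
  -- Increasing strictly from the limit 0, `d x * z` is positive at `x`, against `z d ≤ 0`.
  have hstrict : StrictMonoOn (fun t => d x * z t) (Ioc 0 x) := by
    refine strictMonoOn_of_hasDerivWithinAt_pos (convex_Ioc 0 x) (f' := fun t => d x * d t)
      (fun t ht => ((hz t (hsub ht)).const_mul (d x)).continuousAt.continuousWithinAt) ?_ ?_
    · intro t ht
      exact ((hz t (hsub (interior_subset ht))).const_mul (d x)).hasDerivWithinAt
    · intro t ht
      exact hsign t (interior_subset ht)
  have hx2 : x / 2 ∈ Ioc 0 x := ⟨by linarith [hx.1], by linarith [hx.1]⟩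
  have hlt : d x * z (x / 2) < d x * z x := hstrict hx2 ⟨hx.1, le_rfl⟩ (by linarith [hx.1])
  have hge : 0 ≤ d x * z (x / 2) := by
    have hl : Tendsto (fun t => d x * z t) (𝓝[>] 0) (𝓝 0) := by
      simpa using hz0.const_mul (d x)
    refine le_of_tendsto hl ?_
    filter_upwards [Ioo_mem_nhdsGT hx2.1] with y hy
    exact hstrict.monotoneOn ⟨hy.1, hy.2.le.trans hx2.2⟩ hx2 hy.2.le
  have := hle x hxI
  linarith [mul_comm (z x) (d x)]

namespace IsNeumannSolution

variable {α : ℝ} {p : ℝ≥0∞} {f u v : ℝ → ℝ}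

/-- The first weak derivative has a weak derivative itself, hence a continuous version, and this is
the classical derivative of the continuous function `u`. -/
theorem exists_hasDerivAt (hu : IsNeumannSolution α p f u) :
    ∃ u' : ℝ → ℝ, ContinuousOn u' (Ioo 0 1) ∧ ∀ x ∈ Ioo (0 : ℝ) 1, HasDerivAt u (u' x) x := by
  obtain ⟨u₁, u₂, h1, h2, -⟩ := hu.memW2pLoc
  obtain ⟨G, hG, hG'⟩ := h2.exists_hasACDeriv
  have hac := h1.hasACDeriv (hu.continuousOn.mono Ioo_subset_Ioc_self)
  exact ⟨G, hG.continuousOn, fun x hx => hac.hasDerivAt hG' hG.continuousOn hx⟩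

theorem hasDerivAt (hu : IsNeumannSolution α p f u) {x : ℝ} (hx : x ∈ Ioo (0 : ℝ) 1) :
    HasDerivAt u (deriv u x) x := by
  obtain ⟨u', -, h⟩ := hu.exists_hasDerivAt
  exact (h x hx).differentiableAt.hasDerivAt

theorem continuousOn_deriv (hu : IsNeumannSolution α p f u) : ContinuousOn (deriv u) (Ioo 0 1) := by
  obtain ⟨u', hc, h⟩ := hu.exists_hasDerivAt
  exact hc.congr fun x hx => (h x hx).deriv

theorem hasACDeriv_flux (hu : IsNeumannSolution α p f u) :
    HasACDeriv (fun x => x ^ (2 * α) * deriv u x) (fun x => u x - f x) := by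
  obtain ⟨w, hw, hw'⟩ := hu.equation
  have hc : ContinuousOn (fun x => x ^ (2 * α) * deriv u x) (Ioo 0 1) :=
    (continuousOn_id.rpow_const fun x hx => Or.inl hx.1.ne').mul hu.continuousOn_deriv
  refine (hw.hasACDeriv hc).congr_deriv ?_
  filter_upwards [(ae_restrict_iff' measurableSet_Ioo).1 hw'] with x hx hx'
  linarith [hx hx']

theorem eqOn (hu : IsNeumannSolution α p f u) (hv : IsNeumannSolution α p f v) :
    EqOn u v (Ioc 0 1) := by
  have hc : ContinuousOn (fun x => u x - v x) (Ioc 0 1) := hu.continuousOn.sub hv.continuousOn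
  have h0 := eq_zero_of_homogeneous_system (d := fun x => u x - v x)
    (z := fun x => x ^ (2 * α) * deriv u x - x ^ (2 * α) * deriv v x)
    (k := fun x => (x ^ (2 * α))⁻¹) hc
    (by rw [hu.right_boundary, hv.right_boundary, sub_zero])
    (fun x hx => inv_pos.2 (Real.rpow_pos_of_pos hx.1 _)) ?_ ?_
    (by simpa using hu.neumann_boundary.sub hv.neumann_boundary)
  · exact fun x hx => sub_eq_zero.1 (h0 x hx)
  · intro x hx
    have hp := (Real.rpow_pos_of_pos hx.1 (2 * α)).ne'
    convert! (hu.hasDerivAt hx).sub (hv.hasDerivAt hx) using 1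
    field_simp
  · intro x hx
    refine (hu.hasACDeriv_flux.sub hv.hasACDeriv_flux).hasDerivAt (ae_of_all _ fun y _ => ?_)
      (hc.mono Ioo_subset_Ioc_self) hx
    ring

end IsNeumannSolution

/-! ### The regular homogeneous solution as a power series in `x^γ`. -/

theorem summable_of_abs_le_pow_div_factorial {a : ℕ → ℝ} {c : ℝ}
    (ha : ∀ n, |a n| ≤ c ^ n / n.factorial) (t : ℝ) : Summable fun n => a n * t ^ n := by
  refine Summable.of_norm_bounded (Real.summable_pow_div_factorial (c * |t|)) fun n => ?_
  rw [Real.norm_eq_abs, abs_mul, abs_pow, mul_pow, mul_div_right_comm]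
  exact mul_le_mul_of_nonneg_right (ha n) (by positivity)

theorem hasDerivAt_tsum_of_abs_le_pow_div_factorial {a : ℕ → ℝ} {c : ℝ} (hc : 0 ≤ c)
    (ha : ∀ n, |a n| ≤ c ^ n / n.factorial) (t : ℝ) :
    HasDerivAt (fun t => ∑' n, a n * t ^ n) (∑' n, (n + 1) * a (n + 1) * t ^ n) t := by
  set R := |t| + 1 with hR
  have hR0 : 0 ≤ R := by positivity
  -- Uniform majorant of the differentiated terms on the ball of radius `R`; after an index shift it
  -- is `c` times the exponential series of `c R`.
  have hu : Summable fun n : ℕ => c ^ n / n.factorial * (n * R ^ (n - 1)) := by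
    rw [← summable_nat_add_iff 1]
    refine ((Real.summable_pow_div_factorial (c * R)).mul_left c).congr fun n => ?_
    rw [Nat.factorial_succ]
    push_cast
    have : (n.factorial : ℝ) ≠ 0 := by positivity
    have : (n : ℝ) + 1 ≠ 0 := by positivity
    field_simp
    rw [mul_pow]
    ring
  have h := hasDerivAt_tsum_of_isPreconnected (g := fun n t => a n * t ^ n)
    (g' := fun n t => a n * (n * t ^ (n - 1))) (t := Metric.ball 0 R) (y := t) (y₀ := t) hu
    Metric.isOpen_ball (convex_ball _ _).isPreconnected
    (fun n y _ => (hasDerivAt_pow n y).const_mul (a n)) (fun n y hy => ?_) (by simp [hR])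
    (summable_of_abs_le_pow_div_factorial ha t) (by simp [hR])
  · convert! h using 1
    have hs : Summable fun n : ℕ => a n * (n * t ^ (n - 1)) := by
      refine Summable.of_norm_bounded hu fun n => ?_
      rw [norm_mul, norm_mul, norm_pow, Real.norm_eq_abs, RCLike.norm_natCast, Real.norm_eq_abs]
      gcongr
      · exact ha n
      · linarith
    rw [hs.tsum_eq_zero_add]
    simp only [CharP.cast_eq_zero, zero_mul, mul_zero, zero_add, Nat.cast_add, Nat.cast_one,
      add_tsub_cancel_right]
    exact tsum_congr fun n => by ring
  · rw [norm_mul, norm_mul, norm_pow, Real.norm_eq_abs, RCLike.norm_natCast]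
    gcongr
    · exact ha n
    · simpa using (mem_ball_zero_iff.1 hy).le

/-- `φ` is a solution of `(x^{2α} φ')' = φ` on `(0,∞)` with flux `σ = x^{2α} φ'`, regular at `0`. -/
structure IsRegularSolution (α : ℝ) (φ σ : ℝ → ℝ) (A : ℝ) : Prop where
  continuous : Continuous φ
  hasDerivAt : ∀ x, 0 < x → HasDerivAt φ (x ^ (-(2 * α)) * σ x) x
  hasDerivAt_flux : ∀ x, 0 < x → HasDerivAt σ (φ x) x
  one_le : ∀ x, 0 ≤ x → 1 ≤ φ x
  le : ∀ x, 0 ≤ x → x ≤ 1 → φ x ≤ A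
  abs_flux_le : ∀ x, 0 ≤ x → x ≤ 1 → |σ x| ≤ A * x

/-- Taylor coefficients of the series of `σ x / x` in powers of `x^γ`, `γ = 2 - 2α`. -/
noncomputable def fluxCoeff (γ : ℝ) : ℕ → ℝ
  | 0 => 1
  | n + 1 => fluxCoeff γ n / (γ * (n + 1) * (1 + γ * (n + 1)))

theorem fluxCoeff_pos {γ : ℝ} (hγ : 0 < γ) (n : ℕ) : 0 < fluxCoeff γ n := by
  induction n with
  | zero => exact one_pos
  | succ n ih => rw [fluxCoeff]; positivity

/-- The left side is the coefficient of `φ`. The factor `1 + γ (n + 1)` cancels in the recursion,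
leaving division by `γ (n + 1)` at each step. -/
theorem fluxCoeff_mul_le {γ : ℝ} (hγ : 0 < γ) (n : ℕ) :
    (1 + γ * n) * fluxCoeff γ n ≤ (1 / γ) ^ n / n.factorial := by
  induction n with
  | zero => simp [fluxCoeff]
  | succ n ih =>
    have h1 : fluxCoeff γ n ≤ (1 / γ) ^ n / n.factorial := by
      refine le_trans ?_ ih
      have : 0 ≤ γ * n * fluxCoeff γ n := by
        have := fluxCoeff_pos hγ n
        positivity
      linarith
    have h2 : (1 + γ * ((n + 1 : ℕ) : ℝ)) * fluxCoeff γ (n + 1) =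
        fluxCoeff γ n * (1 / γ / (n + 1)) := by
      rw [fluxCoeff]
      push_cast
      have : 1 + γ * ((n : ℝ) + 1) ≠ 0 := by positivity
      field_simp
    rw [h2]
    calc fluxCoeff γ n * (1 / γ / (n + 1)) ≤ (1 / γ) ^ n / n.factorial * (1 / γ / (n + 1)) := by
          gcongr
      _ = _ := by
          rw [Nat.factorial_succ, pow_succ]
          push_cast
          have : (n.factorial : ℝ) ≠ 0 := by positivity
          field_simp

/-- With `t = x^γ`, `φ = g(t)` and `σ = x h(t)`, the system becomes `g' = h / γ`, `g = h + γ t h'`,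
which the recursion of `fluxCoeff` solves. The coefficients are positive with constant term 1,
whence `φ ≥ 1`. -/
theorem exists_isRegularSolution {α : ℝ} (hα : α < 1) :
    ∃ φ σ A, 1 ≤ A ∧ IsRegularSolution α φ σ A := by
  set γ := 2 - 2 * α with hγ'
  have hγ : 0 < γ := by linarith
  set b := fluxCoeff γ with hb
  have hb0 : ∀ n, 0 < b n := fluxCoeff_pos hγ
  have hg : ∀ n, |(1 + γ * n) * b n| ≤ (1 / γ) ^ n / n.factorial := fun n => by
    have := hb0 n
    rw [abs_of_nonneg (by positivity)]
    exact fluxCoeff_mul_le hγ n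
  have hh : ∀ n, |b n| ≤ (1 / γ) ^ n / n.factorial := fun n => by
    refine le_trans ?_ (hg n)
    rw [abs_of_pos (hb0 n), abs_of_nonneg (by have := hb0 n; positivity)]
    have : 0 ≤ γ * n * b n := by have := hb0 n; positivity
    linarith
  set g : ℝ → ℝ := fun t => ∑' n, (1 + γ * n) * b n * t ^ n with hgdef
  set h : ℝ → ℝ := fun t => ∑' n, b n * t ^ n with hhdef
  set h' : ℝ → ℝ := fun t => ∑' n : ℕ, (n + 1) * b (n + 1) * t ^ n with hh'def
  have hγ1 : 0 ≤ 1 / γ := by positivity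
  have dh : ∀ t, HasDerivAt h (h' t) t := hasDerivAt_tsum_of_abs_le_pow_div_factorial hγ1 hh
  have dg : ∀ t, HasDerivAt g (h t / γ) t := by
    intro t
    convert! hasDerivAt_tsum_of_abs_le_pow_div_factorial hγ1 hg t using 1
    rw [hhdef, ← tsum_div_const]
    refine tsum_congr fun n => ?_
    rw [hb, fluxCoeff]
    push_cast
    have : 1 + γ * ((n : ℝ) + 1) ≠ 0 := by positivity
    field_simp
  have gh : ∀ t, g t = h t + γ * t * h' t := by
    intro t
    have s1 := summable_of_abs_le_pow_div_factorial hg t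
    have s2 := summable_of_abs_le_pow_div_factorial hh t
    have s3 : Summable fun n : ℕ => γ * n * b n * t ^ n := by
      refine (s1.sub s2).congr fun n => ?_
      ring
    have e1 : g t = ∑' n, b n * t ^ n + ∑' n : ℕ, γ * n * b n * t ^ n := by
      rw [← s2.tsum_add s3]
      exact tsum_congr fun n => by ring
    rw [e1, s3.tsum_eq_zero_add, hh'def, ← tsum_mul_left]
    simp only [CharP.cast_eq_zero, mul_zero, zero_mul, zero_add]
    congr 1
    exact tsum_congr fun n => by push_cast; ring
  have g1 : ∀ t, 0 ≤ t → 1 ≤ g t := by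
    intro t ht
    have := (summable_of_abs_le_pow_div_factorial hg t).le_tsum 0 fun n _ => by
      have := hb0 n
      positivity
    simpa [hb, fluxCoeff] using this
  have hgc : Continuous g := continuous_iff_continuousAt.2 fun t => (dg t).continuousAt
  have hhc : Continuous h := continuous_iff_continuousAt.2 fun t => (dh t).continuousAt
  obtain ⟨A₁, hA₁⟩ := (isCompact_Icc (a := (0 : ℝ)) (b := 1)).exists_bound_of_continuousOn
    hgc.continuousOn
  obtain ⟨A₂, hA₂⟩ := (isCompact_Icc (a := (0 : ℝ)) (b := 1)).exists_bound_of_continuousOn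
    hhc.continuousOn
  have hmem : ∀ x : ℝ, 0 ≤ x → x ≤ 1 → x ^ γ ∈ Icc (0 : ℝ) 1 := fun x h0 h1 =>
    ⟨Real.rpow_nonneg h0 _, Real.rpow_le_one h0 h1 hγ.le⟩
  refine ⟨fun x => g (x ^ γ), fun x => x * h (x ^ γ), max 1 (max A₁ A₂), le_max_left _ _,
    hgc.comp (Real.continuous_rpow_const hγ.le), ?_, ?_, fun x hx => g1 _ (Real.rpow_nonneg hx _),
    ?_, ?_⟩
  · intro x hx
    have := (dg (x ^ γ)).comp x (Real.hasDerivAt_rpow_const (p := γ) (Or.inl hx.ne'))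
    convert! this using 1
    have e : x ^ (γ - 1) = x ^ (-(2 * α)) * x := by
      rw [← Real.rpow_add_one hx.ne']
      congr 1
      linarith
    rw [e]
    field_simp
  · intro x hx
    have := (hasDerivAt_id x).mul
      ((dh (x ^ γ)).comp x (Real.hasDerivAt_rpow_const (p := γ) (Or.inl hx.ne')))
    convert! this using 1
    have e : x ^ γ = x ^ (γ - 1) * x := by
      rw [← Real.rpow_add_one hx.ne']
      congr 1
      linarith
    rw [gh]
    simp only [id, Function.comp]
    nth_rewrite 2 [e]
    ring
  · intro x h0 h1
    exact ((le_abs_self _).trans (hA₁ _ (hmem x h0 h1))).trans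
      ((le_max_left _ _).trans (le_max_right _ _))
  · intro x h0 h1
    rw [abs_mul, abs_of_nonneg h0, mul_comm]
    refine mul_le_mul_of_nonneg_right ?_ h0
    exact (hA₂ _ (hmem x h0 h1)).trans ((le_max_right _ _).trans (le_max_right _ _))

/-! ### Reduction of order and estimates of the flux. -/

/-- The integral of `φ f` over `(0, x)`, extended to all real `x`. -/
noncomputable def weightedPrimitive (φ f : ℝ → ℝ) (x : ℝ) : ℝ :=
  ∫ t in (0 : ℝ)..x, (Ioo (0 : ℝ) 1).indicator (fun t => φ t * f t) t

/-- The factor `V` in the solution `φ V` obtained by reduction of order. -/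
noncomputable def reducedSolution (α : ℝ) (φ f : ℝ → ℝ) (x : ℝ) : ℝ :=
  ∫ s in x..1, s ^ (-(2 * α)) * (weightedPrimitive φ f s / φ s ^ 2)

/-- The flux `x^{2α} u'` of the solution `u = φ V`. -/
noncomputable def neumannFlux (α : ℝ) (φ σ f : ℝ → ℝ) (x : ℝ) : ℝ :=
  σ x * reducedSolution α φ f x - weightedPrimitive φ f x / φ x

theorem abs_intervalIntegral_rpow_mul_le {g : ℝ → ℝ} {a β x M : ℝ} (hx : 0 < x) (hx1 : x ≤ 1)
    (hβ : β < 1) (hg : ∀ s ∈ Ioc x 1, |s ^ a * g s| ≤ M * s ^ (-β)) (hM : 0 ≤ M) :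
    |∫ s in x..1, s ^ a * g s| ≤ M * (1 - β)⁻¹ := by
  have hi : IntervalIntegrable (fun s : ℝ => M * s ^ (-β)) volume x 1 :=
    (intervalIntegral.intervalIntegrable_rpow' (by linarith)).const_mul _
  have h1 := intervalIntegral.norm_integral_le_of_norm_le
    (f := fun s => s ^ a * g s) hx1 (ae_of_all _ hg) hi
  refine h1.trans ?_
  rw [intervalIntegral.integral_const_mul, integral_rpow (Or.inl (by linarith)), Real.one_rpow]
  have h2 : 0 ≤ x ^ (1 - β) := Real.rpow_nonneg hx.le _
  have h3 : 0 < 1 - β := by linarith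
  rw [← one_div, neg_add_eq_sub]
  gcongr
  linarith

theorem abs_intervalIntegral_rpow_mul_le' {g : ℝ → ℝ} {a β x M : ℝ} (hx : 0 < x) (hx1 : x ≤ 1)
    (hβ : 0 < β) (hg : ∀ s ∈ Ioc x 1, |s ^ a * g s| ≤ M * s ^ (-β - 1)) (hM : 0 ≤ M) :
    |∫ s in x..1, s ^ a * g s| ≤ M * (x ^ (-β) / β) := by
  have h0 : (0 : ℝ) ∉ uIcc x 1 := by
    rw [uIcc_of_le hx1]
    exact fun h => hx.not_ge h.1
  have hi : IntervalIntegrable (fun s : ℝ => M * s ^ (-β - 1)) volume x 1 :=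
    (intervalIntegral.intervalIntegrable_rpow (Or.inr h0)).const_mul _
  have h1 := intervalIntegral.norm_integral_le_of_norm_le
    (f := fun s => s ^ a * g s) hx1 (ae_of_all _ hg) hi
  refine h1.trans ?_
  rw [intervalIntegral.integral_const_mul, integral_rpow (Or.inr ⟨by linarith, h0⟩), Real.one_rpow,
    sub_add_cancel, ← neg_div_neg_eq, neg_neg]
  gcongr
  linarith

/-- An exponent `β ∈ (0,1)` for which `s^{-2α} ≤ s^{-β-1}` on `(0,1]`. -/
theorem exists_exponent {α : ℝ} (hα : α < 1) :
    ∃ β : ℝ, 0 < β ∧ β < 1 ∧ ∀ s : ℝ, 0 < s → s ≤ 1 → s ^ (-(2 * α)) ≤ s ^ (-β - 1) := by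
  -- The comparison needs `β ≥ 2α - 1`; the value `1/2` keeps `β` positive when `α` is small.
  refine ⟨max (2 * α - 1) (1 / 2), by simp, max_lt (by linarith) (by norm_num), ?_⟩
  intro s hs hs1
  apply Real.rpow_le_rpow_of_exponent_ge hs hs1
  linarith [le_max_left (2 * α - 1) (1 / 2)]

namespace IsRegularSolution

variable {α A : ℝ} {φ σ f : ℝ → ℝ}

theorem pos (hφ : IsRegularSolution α φ σ A) {x : ℝ} (hx : 0 ≤ x) : 0 < φ x :=
  one_pos.trans_le (hφ.one_le x hx)

theorem integrable_indicator (hφ : IsRegularSolution α φ σ A) (hf : IntegrableOn f (Ioo 0 1)) :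
    Integrable ((Ioo (0 : ℝ) 1).indicator fun t => φ t * f t) :=
  (integrable_indicator_iff measurableSet_Ioo).2
    (hf.continuousOn_mul_of_subset hφ.continuous.continuousOn isCompact_Icc measurableSet_Ioo
      Ioo_subset_Icc_self)

theorem continuous_weightedPrimitive (hφ : IsRegularSolution α φ σ A)
    (hf : IntegrableOn f (Ioo 0 1)) : Continuous (weightedPrimitive φ f) :=
  intervalIntegral.continuous_primitive
    (fun _ _ => (hφ.integrable_indicator hf).intervalIntegrable) 0

theorem hasACDeriv_weightedPrimitive (hφ : IsRegularSolution α φ σ A)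
    (hf : IntegrableOn f (Ioo 0 1)) :
    HasACDeriv (weightedPrimitive φ f) (fun x => φ x * f x) :=
  (HasACDeriv.of_integral_zero (hφ.integrable_indicator hf)).congr_deriv
    (ae_of_all _ fun _ hx => indicator_of_mem hx _)

theorem abs_weightedPrimitive_le (hφ : IsRegularSolution α φ σ A) (hf : IntegrableOn f (Ioo 0 1))
    {x : ℝ} (hx : 0 ≤ x) (hx1 : x ≤ 1) :
    |weightedPrimitive φ f x| ≤ A * ∫ t in Ioo 0 x, |f t| := by
  have hf' : IntegrableOn f (Ioo 0 x) := hf.mono_set (Ioo_subset_Ioo le_rfl hx1)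
  rw [weightedPrimitive, intervalIntegral.integral_of_le hx, integral_Ioc_eq_integral_Ioo,
    ← integral_const_mul, ← Real.norm_eq_abs]
  refine norm_integral_le_of_norm_le (hf'.abs.const_mul A) ?_
  refine (ae_restrict_iff' measurableSet_Ioo).2 (ae_of_all _ fun t ht => ?_)
  have ht' : t ∈ Ioo (0 : ℝ) 1 := ⟨ht.1, ht.2.trans_le hx1⟩
  rw [indicator_of_mem ht', norm_mul, Real.norm_eq_abs, Real.norm_eq_abs,
    abs_of_pos (hφ.pos ht.1.le)]
  exact mul_le_mul_of_nonneg_right (hφ.le t ht.1.le (ht.2.le.trans hx1)) (abs_nonneg _)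

theorem continuousOn_integrand (hφ : IsRegularSolution α φ σ A) (hf : IntegrableOn f (Ioo 0 1)) :
    ContinuousOn (fun s => s ^ (-(2 * α)) * (weightedPrimitive φ f s / φ s ^ 2)) (Ioi 0) :=
  (continuousOn_id.rpow_const fun _ hx => Or.inl (ne_of_gt hx)).mul
    ((hφ.continuous_weightedPrimitive hf).continuousOn.div (hφ.continuous.pow 2).continuousOn
      fun _ hx => pow_ne_zero _ (hφ.pos (le_of_lt hx)).ne')

theorem hasDerivAt_reducedSolution (hφ : IsRegularSolution α φ σ A)
    (hf : IntegrableOn f (Ioo 0 1)) {x : ℝ} (hx : 0 < x) :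
    HasDerivAt (reducedSolution α φ f)
      (-(x ^ (-(2 * α)) * (weightedPrimitive φ f x / φ x ^ 2))) x := by
  have hc := hφ.continuousOn_integrand hf
  refine intervalIntegral.integral_hasDerivAt_left ?_
    (hc.stronglyMeasurableAtFilter isOpen_Ioi x hx) (hc.continuousAt (isOpen_Ioi.mem_nhds hx))
  exact (hc.mono (ordConnected_Ioi.uIcc_subset hx (mem_Ioi.2 one_pos))).intervalIntegrable

theorem hasDerivAt_solution (hφ : IsRegularSolution α φ σ A)
    (hf : IntegrableOn f (Ioo 0 1)) {x : ℝ} (hx : 0 < x) :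
    HasDerivAt (fun x => φ x * reducedSolution α φ f x)
      (x ^ (-(2 * α)) * neumannFlux α φ σ f x) x := by
  convert! (hφ.hasDerivAt x hx).mul (hφ.hasDerivAt_reducedSolution hf hx) using 1
  have := (hφ.pos hx.le).ne'
  rw [neumannFlux]
  field_simp
  ring

theorem continuousOn_flux (hφ : IsRegularSolution α φ σ A) (hf : IntegrableOn f (Ioo 0 1)) :
    ContinuousOn (neumannFlux α φ σ f) (Ioi 0) := fun x hx =>
  (((hφ.hasDerivAt_flux x hx).continuousAt.mul
    (hφ.hasDerivAt_reducedSolution hf hx).continuousAt).sub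
    ((hφ.continuous_weightedPrimitive hf).continuousAt.div hφ.continuous.continuousAt
      (hφ.pos (le_of_lt hx)).ne')).continuousWithinAt

/-- In the derivative of `σ V - J / φ`, the terms `σ V'` and `-J (1/φ)'` cancel. -/
theorem hasACDeriv_flux (hφ : IsRegularSolution α φ σ A) (hf : IntegrableOn f (Ioo 0 1)) :
    HasACDeriv (neumannFlux α φ σ f) (fun x => φ x * reducedSolution α φ f x - f x) := by
  have hσc : ContinuousOn σ (Ioo 0 1) := fun x hx =>
    (hφ.hasDerivAt_flux x hx.1).continuousAt.continuousWithinAt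
  have hrc : ContinuousOn (fun x : ℝ => x ^ (-(2 * α))) (Ioo 0 1) :=
    continuousOn_id.rpow_const fun x hx => Or.inl (ne_of_gt hx.1)
  have h1 : HasACDeriv σ φ := .of_hasDerivAt hφ.continuous.continuousOn
    fun x hx => hφ.hasDerivAt_flux x hx.1
  have h2 : HasACDeriv (reducedSolution α φ f) _ :=
    .of_hasDerivAt ((hφ.continuousOn_integrand hf).mono fun x hx => hx.1).neg
      fun x hx => hφ.hasDerivAt_reducedSolution hf hx.1
  have h3 : HasACDeriv (fun x => (φ x)⁻¹) (fun x => -(x ^ (-(2 * α)) * σ x) / φ x ^ 2) :=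
    .of_hasDerivAt ((hrc.mul hσc).neg.div (hφ.continuous.pow 2).continuousOn
      fun x hx => pow_ne_zero _ (hφ.pos hx.1.le).ne')
      fun x hx => (hφ.hasDerivAt x hx.1).inv (hφ.pos hx.1.le).ne'
  refine ((h1.mul h2).sub ((hφ.hasACDeriv_weightedPrimitive hf).mul h3)).congr_deriv
    (ae_of_all _ fun x hx => ?_)
  have := (hφ.pos hx.1.le).ne'
  simp only [Pi.neg_apply]
  field_simp
  ring

theorem abs_integrand_le (hφ : IsRegularSolution α φ σ A) {β : ℝ}
    (hβ : ∀ s : ℝ, 0 < s → s ≤ 1 → s ^ (-(2 * α)) ≤ s ^ (-β - 1)) {s : ℝ} (hs : 0 < s)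
    (hs1 : s ≤ 1) : |s ^ (-(2 * α)) * (weightedPrimitive φ f s / φ s ^ 2)| ≤
      |weightedPrimitive φ f s| * s ^ (-β - 1) := by
  have h1 := hφ.one_le s hs.le
  have h2 : |weightedPrimitive φ f s / φ s ^ 2| ≤ |weightedPrimitive φ f s| := by
    rw [abs_div, abs_of_nonneg (sq_nonneg (φ s))]
    exact div_le_self (abs_nonneg _) (one_le_pow₀ h1)
  rw [abs_mul, abs_of_nonneg (Real.rpow_nonneg hs.le _), mul_comm]
  exact mul_le_mul h2 (hβ s hs hs1) (Real.rpow_nonneg hs.le _) (abs_nonneg _)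

/-- The factor `x^{1-β}` tends to 0 when `β < 1`. This serves the Neumann condition, and the lower
bound, where `J` is constant beyond `x`. -/
theorem mul_abs_reducedSolution_le (hφ : IsRegularSolution α φ σ A) {β : ℝ} (hβ0 : 0 < β)
    (hβ : ∀ s : ℝ, 0 < s → s ≤ 1 → s ^ (-(2 * α)) ≤ s ^ (-β - 1)) {x M : ℝ} (hx : 0 < x)
    (hx1 : x ≤ 1) (hM0 : 0 ≤ M) (hM : ∀ s, x < s → s ≤ 1 → |weightedPrimitive φ f s| ≤ M) :
    x * |reducedSolution α φ f x| ≤ M * (x ^ (1 - β) / β) := by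
  have h := abs_intervalIntegral_rpow_mul_le' (a := -(2 * α))
    (g := fun s => weightedPrimitive φ f s / φ s ^ 2) hx hx1 hβ0 (fun s hs =>
      (hφ.abs_integrand_le hβ (hx.trans hs.1) hs.2).trans (mul_le_mul_of_nonneg_right
        (hM s hs.1 hs.2) (Real.rpow_nonneg (hx.trans hs.1).le _))) hM0
  refine (mul_le_mul_of_nonneg_left h hx.le).trans_eq ?_
  rw [show 1 - β = -β + 1 by ring, Real.rpow_add_one hx.ne']
  ring

/-- For the upper bound: as `θ ≤ 1`, `s^{θ-1} ≤ x^{θ-1}` for `s > x`, and the remaining `s^{-β}` is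
integrable at 0. -/
theorem mul_abs_reducedSolution_le_of_rpow (hφ : IsRegularSolution α φ σ A) {β : ℝ} (hβ1 : β < 1)
    (hβ : ∀ s : ℝ, 0 < s → s ≤ 1 → s ^ (-(2 * α)) ≤ s ^ (-β - 1)) {x M θ : ℝ} (hθ1 : θ ≤ 1)
    (hx : 0 < x) (hx1 : x ≤ 1) (hM0 : 0 ≤ M)
    (hM : ∀ s, x < s → s ≤ 1 → |weightedPrimitive φ f s| ≤ M * s ^ θ) :
    x * |reducedSolution α φ f x| ≤ M * x ^ θ * (1 - β)⁻¹ := by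
  have h := abs_intervalIntegral_rpow_mul_le (a := -(2 * α)) (β := β) (M := M * x ^ (θ - 1))
    (g := fun s => weightedPrimitive φ f s / φ s ^ 2) hx hx1 hβ1 (fun s hs => ?_)
    (mul_nonneg hM0 (Real.rpow_nonneg hx.le _))
  · refine (mul_le_mul_of_nonneg_left h hx.le).trans_eq ?_
    rw [Real.rpow_sub_one hx.ne']
    field_simp
  · have hs0 := hx.trans hs.1
    refine (hφ.abs_integrand_le hβ hs0 hs.2).trans ?_
    refine (mul_le_mul_of_nonneg_right (hM s hs.1 hs.2) (Real.rpow_nonneg hs0.le _)).trans ?_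
    have e : M * s ^ θ * s ^ (-β - 1) = M * s ^ (θ - 1) * s ^ (-β) := by
      rw [mul_assoc, mul_assoc, ← Real.rpow_add hs0, ← Real.rpow_add hs0]
      ring_nf
    rw [e]
    have h3 : s ^ (θ - 1) ≤ x ^ (θ - 1) :=
      Real.rpow_le_rpow_of_nonpos hx hs.1.le (by linarith)
    have := Real.rpow_nonneg hs0.le (-β)
    gcongr

theorem abs_neumannFlux_add_le (hφ : IsRegularSolution α φ σ A) {x : ℝ} (hx : 0 ≤ x)
    (hx1 : x ≤ 1) : |neumannFlux α φ σ f x + weightedPrimitive φ f x / φ x| ≤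
      A * (x * |reducedSolution α φ f x|) := by
  rw [neumannFlux, sub_add_cancel, abs_mul, ← mul_assoc]
  exact mul_le_mul_of_nonneg_right (hφ.abs_flux_le x hx hx1) (abs_nonneg _)

theorem abs_neumannFlux_le (hφ : IsRegularSolution α φ σ A) {x : ℝ} (hx : 0 ≤ x)
    (hx1 : x ≤ 1) : |neumannFlux α φ σ f x| ≤
      A * (x * |reducedSolution α φ f x|) + |weightedPrimitive φ f x| := by
  have h1 := hφ.abs_neumannFlux_add_le (f := f) hx hx1
  have h2 : |weightedPrimitive φ f x / φ x| ≤ |weightedPrimitive φ f x| := by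
    rw [abs_div, abs_of_pos (hφ.pos hx)]
    exact div_le_self (abs_nonneg _) (hφ.one_le x hx)
  have h3 := abs_sub (neumannFlux α φ σ f x + weightedPrimitive φ f x / φ x)
    (weightedPrimitive φ f x / φ x)
  rw [add_sub_cancel_right] at h3
  linarith

theorem tendsto_neumannFlux (hφ : IsRegularSolution α φ σ A) (hα : α < 1)
    (hf : IntegrableOn f (Ioo 0 1)) : Tendsto (neumannFlux α φ σ f) (𝓝[>] 0) (𝓝 0) := by
  obtain ⟨β, hβ0, hβ1, hβ⟩ := exists_exponent hα
  have hJ := hφ.continuous_weightedPrimitive hf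
  obtain ⟨M, hM⟩ := (isCompact_Icc (a := (0 : ℝ)) (b := 1)).exists_bound_of_continuousOn
    hJ.continuousOn
  have hM0 : 0 ≤ M := (norm_nonneg _).trans (hM 1 (by norm_num))
  have hA : 0 ≤ A := zero_le_one.trans ((hφ.one_le 0 le_rfl).trans (hφ.le 0 le_rfl zero_le_one))
  have hl : Tendsto (fun x => A * (M * (x ^ (1 - β) / β)) + |weightedPrimitive φ f x|)
      (𝓝[>] 0) (𝓝 0) := by
    have hc : Continuous fun x => A * (M * (x ^ (1 - β) / β)) + |weightedPrimitive φ f x| :=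
      (continuous_const.mul (continuous_const.mul
        ((Real.continuous_rpow_const (by linarith)).div_const _))).add hJ.abs
    have := (hc.tendsto 0).mono_left (nhdsWithin_le_nhds (s := Ioi 0))
    simpa [weightedPrimitive, Real.zero_rpow (show 1 - β ≠ 0 by linarith)] using this
  refine squeeze_zero_norm' ?_ hl
  filter_upwards [Ioo_mem_nhdsGT (zero_lt_one' ℝ)] with x hx
  refine (hφ.abs_neumannFlux_le hx.1.le hx.2.le).trans ?_
  refine add_le_add_left (mul_le_mul_of_nonneg_left ?_ hA) _
  exact hφ.mul_abs_reducedSolution_le hβ0 hβ hx.1 hx.2.le hM0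
    fun s hs hs1 => hM s ⟨(hx.1.trans hs).le, hs1⟩

end IsRegularSolution

/-! ### `L^p` estimates and the extremal right-hand side. -/

theorem memLp_Ioo_of_continuousOn {g : ℝ → ℝ} (hg : ContinuousOn g (Ioi 0)) (p : ℝ≥0∞) {ε : ℝ}
    (hε : 0 < ε) : MemLp g p (volume.restrict (Ioo ε 1)) := by
  obtain ⟨C, hC⟩ := (isCompact_Icc (a := ε) (b := 1)).exists_bound_of_continuousOn
    (hg.mono fun x hx => hε.trans_le hx.1)
  refine MemLp.of_bound ((hg.mono fun x hx => hε.trans hx.1).aestronglyMeasurable measurableSet_Ioo)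
    C ((ae_restrict_iff' measurableSet_Ioo).2 (ae_of_all _ fun x hx => hC x ⟨hx.1.le, hx.2.le⟩))

theorem integrableOn_of_memLp {f : ℝ → ℝ} {p : ℝ≥0∞} (hp : 1 ≤ p)
    (hf : MemLp f p (volume.restrict (Ioo 0 1))) : IntegrableOn f (Ioo 0 1) :=
  hf.integrable hp

/-- Hölder's inequality on `(0, x)`. -/
theorem integral_abs_le_rpow {f : ℝ → ℝ} {p : ℝ≥0∞} (hp : 1 ≤ p)
    (hf : MemLp f p (volume.restrict (Ioo 0 1)))
    (hf1 : eLpNorm f p (volume.restrict (Ioo 0 1)) ≤ 1) {x : ℝ} (hx : 0 < x) (hx1 : x ≤ 1) :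
    ∫ t in Ioo 0 x, |f t| ≤ x ^ (1 - (p⁻¹).toReal) := by
  have hle : volume.restrict (Ioo 0 x) ≤ volume.restrict (Ioo (0 : ℝ) 1) :=
    Measure.restrict_mono (Ioo_subset_Ioo le_rfl hx1) le_rfl
  have hfx := hf.mono_measure hle
  have h1 := eLpNorm_le_eLpNorm_mul_rpow_measure_univ hp hfx.aestronglyMeasurable
  have h2 : ENNReal.ofReal (∫ t in Ioo 0 x, ‖f t‖) ≤ ENNReal.ofReal (x ^ (1 - (p⁻¹).toReal)) := by
    rw [ofReal_integral_norm_eq_lintegral_enorm (hfx.integrable hp), ← eLpNorm_one_eq_lintegral_enorm]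
    refine h1.trans ?_
    rw [Measure.restrict_apply_univ, Real.volume_Ioo, sub_zero, ENNReal.ofReal_rpow_of_pos hx,
      ENNReal.toReal_one, one_div_one, one_div, ENNReal.toReal_inv]
    refine (mul_le_mul_left ((eLpNorm_mono_measure f hle).trans hf1) _).trans_eq (one_mul _)
  exact (ENNReal.ofReal_le_ofReal_iff (Real.rpow_nonneg hx.le _)).1 h2

theorem toReal_inv_mem_Icc {p : ℝ≥0∞} (hp : 1 ≤ p) : (p⁻¹).toReal ∈ Icc (0 : ℝ) 1 := by
  refine ⟨ENNReal.toReal_nonneg, ?_⟩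
  have h := ENNReal.toReal_mono ENNReal.one_ne_top (ENNReal.inv_le_one.2 hp)
  simpa using h

/-- The normalized indicator function of `(0, x)`. -/
noncomputable def normalizedIndicator (p : ℝ≥0∞) (x : ℝ) : ℝ → ℝ :=
  (Ioo 0 x).indicator fun _ => x ^ (-(p⁻¹).toReal)

theorem memLp_normalizedIndicator (p : ℝ≥0∞) (x : ℝ) :
    MemLp (normalizedIndicator p x) p (volume.restrict (Ioo 0 1)) :=
  (memLp_const _).indicator measurableSet_Ioo

theorem eLpNorm_normalizedIndicator_le (p : ℝ≥0∞) {x : ℝ} (hx : 0 < x) :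
    eLpNorm (normalizedIndicator p x) p (volume.restrict (Ioo 0 1)) ≤ 1 := by
  refine (eLpNorm_mono_measure _ Measure.restrict_le_self).trans ?_
  refine (eLpNorm_indicator_const_le _ p).trans_eq ?_
  rw [Real.volume_Ioo, sub_zero, ENNReal.ofReal_rpow_of_pos hx,
    Real.enorm_of_nonneg (Real.rpow_nonneg hx.le _), ← ENNReal.ofReal_mul (Real.rpow_nonneg hx.le _),
    ← Real.rpow_add hx, ENNReal.toReal_inv, one_div, neg_add_cancel, Real.rpow_zero,
    ENNReal.ofReal_one]

/-! ### Existence, and the two bounds for `K_N`. -/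

namespace IsRegularSolution

variable {α A : ℝ} {φ σ f : ℝ → ℝ} {p : ℝ≥0∞}

theorem deriv_solution (hφ : IsRegularSolution α φ σ A) (hf : IntegrableOn f (Ioo 0 1)) {x : ℝ}
    (hx : 0 < x) : x ^ (2 * α) * deriv (fun x => φ x * reducedSolution α φ f x) x =
      neumannFlux α φ σ f x := by
  rw [(hφ.hasDerivAt_solution hf hx).deriv, Real.rpow_neg hx.le,
    mul_inv_cancel_left₀ (Real.rpow_pos_of_pos hx _).ne']

theorem isNeumannSolution (hφ : IsRegularSolution α φ σ A) (hα : α < 1) (hp : 1 ≤ p)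
    (hf : MemLp f p (volume.restrict (Ioo 0 1))) :
    IsNeumannSolution α p f (fun x => φ x * reducedSolution α φ f x) := by
  have hfi := integrableOn_of_memLp hp hf
  have hw := hφ.hasACDeriv_flux hfi
  have hwc := hφ.continuousOn_flux hfi
  -- The formulas make sense on all of `(0,∞)`, so 1 is an interior point, and continuity there
  -- gives the bounds on `(ε,1)`.
  have huc : ContinuousOn (fun x => φ x * reducedSolution α φ f x) (Ioi 0) := fun x hx =>
    (hφ.hasDerivAt_solution hfi hx).continuousAt.continuousWithinAt
  have hrc : ∀ a : ℝ, ContinuousOn (fun x : ℝ => x ^ a) (Ioi 0) := fun a =>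
    continuousOn_id.rpow_const fun x hx => Or.inl (ne_of_gt hx)
  have hsub : Ioo (0 : ℝ) 1 ⊆ Ioi 0 := fun x hx => hx.1
  have hr : HasACDeriv (fun x : ℝ => x ^ (-(2 * α))) (fun x => -(2 * α) * x ^ (-(2 * α) - 1)) :=
    .of_hasDerivAt (continuousOn_const.mul ((hrc _).mono hsub))
      fun x hx => Real.hasDerivAt_rpow_const (Or.inl hx.1.ne')
  refine ⟨huc.mono fun x hx => hx.1, ⟨fun x => x ^ (-(2 * α)) * neumannFlux α φ σ f x, _,
    (HasACDeriv.of_hasDerivAt (((hrc _).mul hwc).mono hsub)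
      fun x hx => hφ.hasDerivAt_solution hfi hx.1).hasWeakDeriv, (hr.mul hw).hasWeakDeriv,
    fun ε hε _ => ⟨memLp_Ioo_of_continuousOn huc p hε,
      memLp_Ioo_of_continuousOn ((hrc _).mul hwc) p hε, ?_⟩⟩, ?_, ?_, ?_⟩
  -- `u'' = (x^{-2α})' w + x^{-2α} (u - f)`, where `w` is the flux: a function continuous on `(0,∞)`
  -- plus an `L^∞` function times an `L^p` function.
  · refine (memLp_Ioo_of_continuousOn ((continuousOn_const.mul (hrc _)).mul hwc) p hε).add ?_
    refine MemLp.mul' (p := ∞) (q := p) ?_ (memLp_Ioo_of_continuousOn (hrc _) ∞ hε)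
    exact (memLp_Ioo_of_continuousOn huc p hε).sub
      (hf.mono_measure (Measure.restrict_mono (Ioo_subset_Ioo hε.le le_rfl) le_rfl))
  · refine ⟨_, (hw.congr fun x hx => hφ.deriv_solution hfi hx.1).hasWeakDeriv, ae_of_all _ fun x => ?_⟩
    ring
  · simp [reducedSolution]
  · refine (hφ.tendsto_neumannFlux hα hfi).congr' ?_
    filter_upwards [self_mem_nhdsWithin] with x hx using (hφ.deriv_solution hfi hx).symm

/-- By uniqueness, any solution admitted in the supremum may be replaced by `φ V`. -/
theorem abs_rate_eq (hφ : IsRegularSolution α φ σ A) (hα : α < 1) (hp : 1 ≤ p)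
    (hf : MemLp f p (volume.restrict (Ioo 0 1))) {u : ℝ → ℝ} (hu : IsNeumannSolution α p f u)
    {x : ℝ} (hx : 0 < x) (hx1 : x < 1) :
    |x ^ (2 * α - 1 + (p⁻¹).toReal) * deriv u x| =
      (x ^ (1 - (p⁻¹).toReal))⁻¹ * |neumannFlux α φ σ f x| := by
  have he : deriv u x = deriv (fun x => φ x * reducedSolution α φ f x) x := by
    refine EventuallyEq.deriv_eq (((hu.eqOn (hφ.isNeumannSolution hα hp hf)).mono
      Ioo_subset_Ioc_self).eventuallyEq_of_mem (isOpen_Ioo.mem_nhds ⟨hx, hx1⟩))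
  rw [he, ← hφ.deriv_solution (integrableOn_of_memLp hp hf) hx, ← Real.rpow_neg hx.le,
    ← abs_of_pos (Real.rpow_pos_of_pos hx (-(1 - (p⁻¹).toReal))), ← abs_mul, ← mul_assoc,
    ← Real.rpow_add hx]
  ring_nf

theorem neumannK_le (hφ : IsRegularSolution α φ σ A) (hA : 1 ≤ A) (hα : α < 1) (hp : 1 ≤ p) {β : ℝ}
    (hβ1 : β < 1) (hβ : ∀ s : ℝ, 0 < s → s ≤ 1 → s ^ (-(2 * α)) ≤ s ^ (-β - 1)) {x : ℝ}
    (hx : 0 < x) (hx1 : x < 1) :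
    neumannK α p x ≤ ENNReal.ofReal (A * (A * (1 - β)⁻¹ + 1)) := by
  refine iSup_le fun f => iSup_le fun u => iSup_le fun hf => iSup_le fun hf1 => iSup_le fun hu => ?_
  refine ENNReal.ofReal_le_ofReal ?_
  rw [hφ.abs_rate_eq hα hp hf hu hx hx1]
  set θ := 1 - (p⁻¹).toReal with hθ
  have hA0 : 0 ≤ A := zero_le_one.trans hA
  have hJ : ∀ s, 0 < s → s ≤ 1 → |weightedPrimitive φ f s| ≤ A * s ^ θ := fun s hs hs1 =>
    (hφ.abs_weightedPrimitive_le (integrableOn_of_memLp hp hf) hs.le hs1).trans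
      (mul_le_mul_of_nonneg_left (integral_abs_le_rpow hp hf hf1 hs hs1) hA0)
  have h1 := hφ.mul_abs_reducedSolution_le_of_rpow hβ1 hβ (θ := θ)
    (by linarith [(toReal_inv_mem_Icc hp).1]) hx hx1.le hA0 fun s hs hs1 => hJ s (hx.trans hs) hs1
  have h2 := hφ.abs_neumannFlux_le (f := f) hx.le hx1.le
  have hxθ := Real.rpow_pos_of_pos hx θ
  rw [inv_mul_le_iff₀ hxθ]
  have h3 := hJ x hx hx1.le
  have h4 := mul_le_mul_of_nonneg_left h1 hA0
  linarith

theorem weightedPrimitive_normalizedIndicator (x : ℝ) {s : ℝ} (hxs : x ≤ s) (hx : 0 < x)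
    (hx1 : x ≤ 1) : weightedPrimitive φ (normalizedIndicator p x) s =
      x ^ (-(p⁻¹).toReal) * ∫ t in Ioo 0 x, φ t := by
  rw [weightedPrimitive, intervalIntegral.integral_of_le (hx.le.trans hxs),
    integral_Ioc_eq_integral_Ioo, ← integral_const_mul]
  have e : (Ioo (0 : ℝ) 1).indicator (fun t => φ t * normalizedIndicator p x t) =
      (Ioo 0 x).indicator fun t => x ^ (-(p⁻¹).toReal) * φ t := by
    funext t
    by_cases ht : t ∈ Ioo 0 x
    · have ht' : t ∈ Ioo (0 : ℝ) 1 := ⟨ht.1, ht.2.trans_le hx1⟩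
      rw [indicator_of_mem ht', indicator_of_mem ht, normalizedIndicator, indicator_of_mem ht, mul_comm]
    · rw [indicator_of_notMem ht, indicator_apply_eq_zero]
      intro _
      rw [normalizedIndicator, indicator_of_notMem ht, mul_zero]
  rw [e, setIntegral_indicator measurableSet_Ioo, Ioo_inter_Ioo, max_self, min_eq_right hxs]

theorem le_neumannK (hφ : IsRegularSolution α φ σ A) (hA : 1 ≤ A) (hα : α < 1) (hp : 1 ≤ p) {β : ℝ}
    (hβ0 : 0 < β) (hβ : ∀ s : ℝ, 0 < s → s ≤ 1 → s ^ (-(2 * α)) ≤ s ^ (-β - 1)) {x : ℝ}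
    (hx : 0 < x) (hx1 : x < 1) (hsmall : A * (A * (x ^ (1 - β) / β)) ≤ (2 * A)⁻¹) :
    ENNReal.ofReal (2 * A)⁻¹ ≤ neumannK α p x := by
  have hf := memLp_normalizedIndicator p x
  have hf1 := eLpNorm_normalizedIndicator_le p hx
  have hu := hφ.isNeumannSolution hα hp hf
  refine le_trans ?_ (le_iSup_of_le (normalizedIndicator p x) (le_iSup_of_le _ (le_iSup_of_le hf
    (le_iSup_of_le hf1 (le_iSup_of_le hu le_rfl)))))
  refine ENNReal.ofReal_le_ofReal ?_
  rw [hφ.abs_rate_eq hα hp hf hu hx hx1]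
  set f := normalizedIndicator p x with hfdef
  set θ := 1 - (p⁻¹).toReal with hθ
  have hA0 : 0 < A := zero_lt_one.trans_le hA
  have hxθ := Real.rpow_pos_of_pos hx θ
  have hprod : x ^ (-(p⁻¹).toReal) * x = x ^ θ := by
    rw [← Real.rpow_add_one hx.ne', hθ, neg_add_eq_sub]
  have hr := Real.rpow_nonneg hx.le (-(p⁻¹).toReal)
  have hφi : IntegrableOn φ (Ioo 0 x) :=
    (hφ.continuous.continuousOn.integrableOn_compact isCompact_Icc).mono_set Ioo_subset_Icc_self
  have hvol : (volume : Measure ℝ).real (Ioo 0 x) = x := by simp [hx.le]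
  have hci : ∀ c : ℝ, IntegrableOn (fun _ : ℝ => c) (Ioo 0 x) := fun c =>
    integrableOn_const (by simp)
  have hlow : x ≤ ∫ t in Ioo 0 x, φ t := by
    have := setIntegral_mono_on (hci 1) hφi measurableSet_Ioo fun t ht => hφ.one_le t ht.1.le
    simpa [setIntegral_const, hvol] using this
  have hup : ∫ t in Ioo 0 x, φ t ≤ A * x := by
    have := setIntegral_mono_on hφi (hci A) measurableSet_Ioo
      fun t ht => hφ.le t ht.1.le (ht.2.le.trans hx1.le)
    rw [setIntegral_const, hvol, smul_eq_mul, mul_comm] at this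
    exact this
  have hJ : ∀ s, x ≤ s → weightedPrimitive φ f s = x ^ (-(p⁻¹).toReal) * ∫ t in Ioo 0 x, φ t :=
    fun s hs => weightedPrimitive_normalizedIndicator x hs hx hx1.le
  have hJlow : ∀ s, x ≤ s → x ^ θ ≤ weightedPrimitive φ f s := fun s hs => by
    rw [hJ s hs, ← hprod]
    exact mul_le_mul_of_nonneg_left hlow hr
  have hJup : ∀ s, x ≤ s → weightedPrimitive φ f s ≤ A * x ^ θ := fun s hs => by
    rw [hJ s hs, ← hprod, mul_left_comm]
    exact mul_le_mul_of_nonneg_left hup hr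
  have h1 := hφ.mul_abs_reducedSolution_le hβ0 hβ (f := f) (M := A * x ^ θ) hx hx1.le (by positivity)
    fun s hs _ => by
      rw [abs_of_nonneg (hxθ.le.trans (hJlow s hs.le))]
      exact hJup s hs.le
  have h2 := hφ.abs_neumannFlux_add_le (f := f) hx.le hx1.le
  -- The main term is at least `x^θ / A`; `hsmall` makes the remainder at most half of that, whence
  -- the constant `(2 * A)⁻¹`.
  have h3 : x ^ θ / A ≤ weightedPrimitive φ f x / φ x := by
    have := hφ.pos hx.le
    exact div_le_div₀ (hxθ.le.trans (hJlow x le_rfl)) (hJlow x le_rfl) this (hφ.le x hx.le hx1.le)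
  have h4 : A * (x * |reducedSolution α φ f x|) ≤ x ^ θ * (2 * A)⁻¹ := by
    refine (mul_le_mul_of_nonneg_left h1 hA0.le).trans ?_
    calc A * (A * x ^ θ * (x ^ (1 - β) / β)) = x ^ θ * (A * (A * (x ^ (1 - β) / β))) := by ring
      _ ≤ _ := mul_le_mul_of_nonneg_left hsmall hxθ.le
  have h5 : x ^ θ / A = 2 * (x ^ θ * (2 * A)⁻¹) := by field_simp
  rw [le_inv_mul_iff₀ hxθ]
  have h6 := (abs_le.1 (h2.trans h4)).2
  have h7 := neg_le_abs (neumannFlux α φ σ f x)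
  linarith

end IsRegularSolution

end SingularSL

theorem mainTheorem4 (α : ℝ) (hα : α < 1) (p : ℝ≥0∞) (hp : 1 ≤ p) :
    (∀ f : ℝ → ℝ, MemLp f p (volume.restrict (Ioo 0 1)) →
      (∃ u : ℝ → ℝ, SingularSL.IsNeumannSolution α p f u) ∧
      ∀ u v : ℝ → ℝ, SingularSL.IsNeumannSolution α p f u →
        SingularSL.IsNeumannSolution α p f v → EqOn u v (Ioc 0 1)) ∧
    ∃ ε₀ C₁ C₂ : ℝ, 0 < ε₀ ∧ ε₀ < 1 ∧ 0 < C₁ ∧ C₁ < C₂ ∧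
      ∀ x : ℝ, 0 < x → x ≤ ε₀ →
        ENNReal.ofReal C₁ ≤ SingularSL.neumannK α p x ∧
        SingularSL.neumannK α p x ≤ ENNReal.ofReal C₂ := by
  obtain ⟨φ, σ, A, hA, hφ⟩ := SingularSL.exists_isRegularSolution hα
  obtain ⟨β, hβ0, hβ1, hβ⟩ := SingularSL.exists_exponent hα
  refine ⟨fun f hf => ⟨⟨_, hφ.isNeumannSolution hα hp hf⟩, fun u v hu hv => hu.eqOn hv⟩, ?_⟩
  have hA0 : 0 < A := zero_lt_one.trans_le hA
  have hc : Continuous fun x : ℝ => A * (A * (x ^ (1 - β) / β)) :=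
    continuous_const.mul (continuous_const.mul
      ((Real.continuous_rpow_const (by linarith)).div_const _))
  -- The smallness condition of `le_neumannK` determines `ε₀`; it holds near 0 because `1 - β > 0`.
  have hev : ∀ᶠ x : ℝ in 𝓝 0, A * (A * (x ^ (1 - β) / β)) < (2 * A)⁻¹ := by
    refine hc.continuousAt.eventually_lt continuousAt_const ?_
    rw [Real.zero_rpow (by linarith), zero_div, mul_zero, mul_zero]
    positivity
  obtain ⟨δ, hδ, hδ'⟩ := Metric.eventually_nhds_iff.1 hev
  have hβ' : 0 < (1 - β)⁻¹ := inv_pos.2 (by linarith)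
  refine ⟨min (δ / 2) (1 / 2), (2 * A)⁻¹, A * (A * (1 - β)⁻¹ + 1), by positivity,
    (min_le_right _ _).trans_lt (by norm_num), by positivity, ?_, fun x hx hxε => ?_⟩
  · have h1 : (2 * A)⁻¹ < 1 := inv_lt_one_of_one_lt₀ (by linarith)
    have h2 : 0 < A * (1 - β)⁻¹ := by positivity
    nlinarith
  · have hx1 : x < 1 := (hxε.trans (min_le_right _ _)).trans_lt (by norm_num)
    have hxδ : x < δ := (hxε.trans (min_le_left _ _)).trans_lt (by linarith)
    refine ⟨hφ.le_neumannK hA hα hp hβ0 hβ hx hx1 (hδ' ?_).le,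
      hφ.neumannK_le hA hα hp hβ1 hβ hx hx1⟩
    rwa [dist_zero_right, Real.norm_of_nonneg hx.le]
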